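/- Let $\mathsf N\ge 1$, let $q\in\mathbb C\setminus\{0\}$ and $\eta_1,\dots,\eta_{\mathsf N}\in\mathbb C\setminus\{0\}$. Let $\sigma^x,\sigma^z$ be the Pauli matrices, $\sigma^+=\begin{pmatrix}0&1\\0&0\end{pmatrix}$, $\sigma^-=\begin{pmatrix}0&0\\1&0\end{pmatrix}$. For $X\in\mathrm{End}(\mathbb C^2)$ let $X_n$ denote $X$ acting on the $n$-th factor of the quantum space $\mathcal R_{\mathsf N}=(\mathbb C^2)^{\otimes\mathsf N}$ (and as the identity on the other factors), and $X_0$ denote $X$ acting on an auxiliary space $\mathrm R_0\simeq\mathbb C^2$; $\mathrm{tr}_0$ and ${}^{t_0}$ are the trace and the transposition with respect to $\mathrm R_0$. Put $x_\pm(\mu)=\tfrac12\big(\mu q-(q\mu)^{-1}\pm(\mu-\mu^{-1})\big)$ and define, as $2\times2$ matrices over $\mathrm R_0$ with entries in $\mathrm{End}(\mathcal R_{\mathsf N})$, the Lax operators and the monodromy matrix $$\mathsf L_{0n}(\mu)=\begin{pmatrix}x_+(\mu)+x_-(\mu)\sigma^z_n&(q-q^{-1})\sigma_n^-\\(q-q^{-1})\sigma_n^+&x_+(\mu)-x_-(\mu)\sigma_n^z\end{pmatrix},\qquad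 \mathsf M_0(\lambda)=\begin{pmatrix}\mathsf A(\lambda)&\mathsf B(\lambda)\\\mathsf C(\lambda)&\mathsf D(\lambda)\end{pmatrix}=\mathsf L_{0\mathsf N}(\lambda/\eta_{\mathsf N})\cdots\mathsf L_{01}(\lambda/\eta_1).$$ Let $\bar{\mathsf T}(\lambda)=\mathsf B(\lambda)+\mathsf C(\lambda)$ be the antiperiodic transfer matrix, and put $$\det\mathsf M(\lambda)=\mathsf A(\lambda)\mathsf D(\lambda/q)-\mathsf B(\lambda)\mathsf C(\lambda/q),\qquad \det\bar{\mathsf M}(\lambda)=\mathsf B(\lambda)\mathsf C(\lambda/q)-\mathsf A(\lambda)\mathsf D(\lambda/q),$$ $$a(\lambda)=-\prod_{m=1}^{\mathsf N}\Big(\frac{\lambda q}{\eta_m}-\frac{\eta_m}{\lambda q}\Big),\qquad d(\lambda)=\prod_{m=1}^{\mathsf N}\Big(\frac{\lambda}{\eta_m}-\frac{\eta_m}{\lambda}\Big).$$ (i) For every $b\in\{1,\dots,\mathsf N\}$, $$\bar{\mathsf T}(\eta_b)\,\bar{\mathsf T}(\eta_b/q)=\det\bar{\mathsf M}(\eta_b)=\mathsf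 B(\eta_b)\mathsf C(\eta_b/q)-\mathsf A(\eta_b)\mathsf D(\eta_b/q),$$ and this operator is the scalar $a(\eta_b)d(\eta_b/q)$ times the identity, while $\det\mathsf M(\eta_b)$ is the scalar $-a(\eta_b)d(\eta_b/q)$ times the identity. (ii) Let $n\in\{1,\dots,\mathsf N\}$ be such that $a(\eta_b)\ne0$ and $d(\eta_b/q)\neq0$ for all $b\le n$ (that is, all the determinants that are divided by below are invertible). Then for every $X\in\mathrm{End}(\mathbb C^2)$ $$X_n=\prod_{b=1}^{n-1}\bar{\mathsf T}(\eta_b)\;\mathrm{tr}_0\big(\mathsf M_0(\eta_n)X_0\sigma_0^x\big)\prod_{b=1}^{n}\frac{\bar{\mathsf T}(\eta_b/q)}{\det\bar{\mathsf M}(\eta_b)}$$ $$\phantom{X_n}=\prod_{b=1}^{n}\bar{\mathsf T}(\eta_b)\;\frac{\mathrm{tr}_0\big(\sigma_0^z\,\mathsf M_0^{t_0}(\eta_n/q)\,\sigma_0^z X_0\sigma_0^x\big)}{\det\mathsf M(\eta_n)}\prod_{b=1}^{n-1}\frac{\bar{\mathsf T}(\eta_b/q)}{\det\bar{\mathsf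 M}(\eta_b)}.$$ Here products over $b$ are ordered with $b$ increasing from left to right. -/

import Mathlib

namespace SixVertex

/-- Operators on the quantum space `(ℂ²)^{⊗ N}` of the chain, as matrices in the basis of spin
configurations `s : Fin N → Fin 2`; `0` stands for spin up (`σᶻ = 1`), `1` for spin down. -/
abbrev Op (N : ℕ) : Type := Matrix (Fin N → Fin 2) (Fin N → Fin 2) ℂ

/-- Operators on `ℂ² ⊗ (ℂ²)^{⊗ N}` (auxiliary space first), as `2 × 2` matrices over the
auxiliary space whose entries are operators on the quantum space. -/
abbrev AuxOp (N : ℕ) : Type := Matrix (Fin 2) (Fin 2) (Op N)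

/-- The Pauli matrix `σˣ`. -/
def sigmaX : Matrix (Fin 2) (Fin 2) ℂ := !![0, 1; 1, 0]

/-- The Pauli matrix `σᶻ`. -/
def sigmaZ : Matrix (Fin 2) (Fin 2) ℂ := !![1, 0; 0, -1]

/-- The raising matrix `σ⁺`. -/
def sigmaPlus : Matrix (Fin 2) (Fin 2) ℂ := !![0, 1; 0, 0]

/-- The lowering matrix `σ⁻`. -/
def sigmaMinus : Matrix (Fin 2) (Fin 2) ℂ := !![0, 0; 1, 0]

/-- The local operator `X_n`: the matrix `X` acting on the `n`-th tensor factor, the identity on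
all the others. -/
def localOp {N : ℕ} (n : Fin N) (X : Matrix (Fin 2) (Fin 2) ℂ) : Op N :=
  fun s t => if ∀ m, m ≠ n → s m = t m then X (s n) (t n) else 0

/-- The operator `X₀`: the matrix `X` acting on the auxiliary space. -/
def auxOp (N : ℕ) (X : Matrix (Fin 2) (Fin 2) ℂ) : AuxOp N :=
  fun i j => X i j • (1 : Op N)

/-- `x₊(μ) = ((μ q - 1/(q μ)) + (μ - 1/μ)) / 2`. -/
noncomputable def xPlus (q μ : ℂ) : ℂ := ((μ * q - (q * μ)⁻¹) + (μ - μ⁻¹)) / 2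

/-- `x₋(μ) = ((μ q - 1/(q μ)) - (μ - 1/μ)) / 2`. -/
noncomputable def xMinus (q μ : ℂ) : ℂ := ((μ * q - (q * μ)⁻¹) - (μ - μ⁻¹)) / 2

/-- The six-vertex Lax operator `L_{0n}(μ)`. -/
noncomputable def lax {N : ℕ} (q : ℂ) (n : Fin N) (μ : ℂ) : AuxOp N :=
  !![xPlus q μ • (1 : Op N) + xMinus q μ • localOp n sigmaZ, (q - q⁻¹) • localOp n sigmaMinus;
     (q - q⁻¹) • localOp n sigmaPlus, xPlus q μ • (1 : Op N) - xMinus q μ • localOp n sigmaZ]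

/-- The monodromy matrix `M₀(z) = L_{0N}(z/η_N) ⋯ L_{01}(z/η_1)`. -/
noncomputable def monodromy {N : ℕ} (q : ℂ) (η : Fin N → ℂ) (z : ℂ) : AuxOp N :=
  ((List.finRange N).reverse.map fun n => lax q n (z / η n)).prod

/-- The Yang-Baxter generator `A(z)`. -/
noncomputable def opA {N : ℕ} (q : ℂ) (η : Fin N → ℂ) (z : ℂ) : Op N := monodromy q η z 0 0

/-- The Yang-Baxter generator `B(z)`. -/
noncomputable def opB {N : ℕ} (q : ℂ) (η : Fin N → ℂ) (z : ℂ) : Op N := monodromy q η z 0 1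

/-- The Yang-Baxter generator `C(z)`. -/
noncomputable def opC {N : ℕ} (q : ℂ) (η : Fin N → ℂ) (z : ℂ) : Op N := monodromy q η z 1 0

/-- The Yang-Baxter generator `D(z)`. -/
noncomputable def opD {N : ℕ} (q : ℂ) (η : Fin N → ℂ) (z : ℂ) : Op N := monodromy q η z 1 1

/-- The antiperiodic transfer matrix `T̄(z) = B(z) + C(z) = tr₀(σ₀ˣ M₀(z))`. -/
noncomputable def antiT {N : ℕ} (q : ℂ) (η : Fin N → ℂ) (z : ℂ) : Op N :=
  opB q η z + opC q η z

/-- The quantum determinant `det M(z) = A(z) D(z/q) - B(z) C(z/q)`. -/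
noncomputable def detM {N : ℕ} (q : ℂ) (η : Fin N → ℂ) (z : ℂ) : Op N :=
  opA q η z * opD q η (z / q) - opB q η z * opC q η (z / q)

/-- The antiperiodic quantum determinant `det M̄(z) = B(z) C(z/q) - A(z) D(z/q)`. -/
noncomputable def detMbar {N : ℕ} (q : ℂ) (η : Fin N → ℂ) (z : ℂ) : Op N :=
  opB q η z * opC q η (z / q) - opA q η z * opD q η (z / q)

/-- `a(z) = - ∏ₙ (z q / ηₙ - ηₙ / (z q))`. -/
noncomputable def aCoeff {N : ℕ} (q : ℂ) (η : Fin N → ℂ) (z : ℂ) : ℂ :=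
  -∏ n, (z * q / η n - η n / (z * q))

/-- `d(z) = ∏ₙ (z / ηₙ - ηₙ / z)`. -/
noncomputable def dCoeff {N : ℕ} (η : Fin N → ℂ) (z : ℂ) : ℂ :=
  ∏ n, (z / η n - η n / z)

/-- The ordered product `F(1) F(2) ⋯ F(n-1)` over the sites strictly before `n`. -/
def prodLT {N : ℕ} (n : Fin N) (F : Fin N → Op N) : Op N :=
  (((List.finRange N).filter (· < n)).map F).prod

/-- The ordered product `F(1) F(2) ⋯ F(n)` over the sites up to and including `n`. -/
def prodLE {N : ℕ} (n : Fin N) (F : Fin N → Op N) : Op N :=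
  (((List.finRange N).filter (· ≤ n)).map F).prod

end SixVertex

/-! The starting point is that the Lax matrix at spectral parameter 1 is `q - q⁻¹` times the
permutation of the auxiliary space with a site, and that the six-vertex `R`-matrix has the same
weights as the Lax matrix.

Reconstruction rests on a shift property. In the monodromy matrix site 1 is the rightmost factor.
Multiplying by `antiT` at the inhomogeneity of that site moves its Lax factor to the far left,
conjugated by `σˣ` (`flip`), because the permutation turns the exchange relation of the remaining
factors into an exchange with the Lax matrix itself (`antiTrace_mul_unitLax`). Iterating over the
sites before `n` (`mono_reverse_shift`) makes site `n` the rightmost one. There the permutation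
converts the auxiliary `X` into the local `X` (`twistTrace_mul_unitLax`), so the ordered product of
transfer matrices before `n`, times the twisted trace, equals the local operator times the product
up to `n` (`prod_mul_twistTrace`).

To remove the transfer matrices on the right, they are inverted by fusion. At the pair `η b`, `η b /
q` the products of monodromy entries are antisymmetric in the row indices (`rowAntisymm_mono`). This
reduces the product of the two transfer matrices to the quantum determinant, a scalar computed site
by site (`qDet_mono`). The same antisymmetry exchanges the two kinds of twisted trace and so deduces
the second reconstruction formula from the first. -/

namespace SixVertex

/-! ### Two by two matrices over a ring -/

/-- All entries of `M` commute with all entries of `M'`. -/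
def EntriesCommute {R : Type*} [Ring R] (M M' : Matrix (Fin 2) (Fin 2) R) : Prop :=
  ∀ i j k l, Commute (M i j) (M' k l)

theorem EntriesCommute.mul_apply_mul_mul_apply {R : Type*} [Ring R]
    {M M' K K' : Matrix (Fin 2) (Fin 2) R} (h : EntriesCommute K M') (i j k l : Fin 2) :
    (M * K) i j * (M' * K') k l = ∑ p, ∑ r, M i p * M' k r * (K p j * K' r l) := by
  simp only [Matrix.mul_apply, Finset.sum_mul_sum]
  refine Finset.sum_congr rfl fun p _ => Finset.sum_congr rfl fun r _ => ?_
  rw [mul_assoc, ← mul_assoc (K p j), (h p j k r).eq]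
  simp only [mul_assoc]

theorem EntriesCommute.symm {R : Type*} [Ring R] {M M' : Matrix (Fin 2) (Fin 2) R}
    (h : EntriesCommute M M') : EntriesCommute M' M := fun i j k l => (h k l i j).symm

theorem EntriesCommute.mul_right {R : Type*} [Ring R] {M M' M'' : Matrix (Fin 2) (Fin 2) R}
    (h : EntriesCommute M M') (h' : EntriesCommute M M'') : EntriesCommute M (M' * M'') := by
  intro i j k l
  rw [Matrix.mul_apply]
  exact Commute.sum_right _ _ _ fun p _ => (h i j k p).mul_right (h' i j p l)

theorem EntriesCommute.mul_left {R : Type*} [Ring R] {M M' M'' : Matrix (Fin 2) (Fin 2) R}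
    (h : EntriesCommute M M'') (h' : EntriesCommute M' M'') : EntriesCommute (M * M') M'' :=
  (h.symm.mul_right h'.symm).symm

theorem entriesCommute_one_left {R : Type*} [Ring R] (M : Matrix (Fin 2) (Fin 2) R) :
    EntriesCommute 1 M := by
  intro i j k l
  rw [Matrix.one_apply]
  split_ifs
  · exact Commute.one_left _
  · exact Commute.zero_left _

/-- Diagonal weights of the six-vertex `R`-matrix. -/
def wDiag (a b : ℂ) (i k : Fin 2) : ℂ := if i = k then a else b

/-- Off-diagonal weights of the six-vertex `R`-matrix. -/
def wOff (c : ℂ) (i k : Fin 2) : ℂ := if i = k then 0 else c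

/-- The exchange relation `R M₁ M'₂ = M'₂ M₁ R` for the six-vertex `R`-matrix with weights
`a`, `b`, `c`, written out in components. -/
def RTT {R : Type*} [Ring R] [Algebra ℂ R] (a b c : ℂ) (M M' : Matrix (Fin 2) (Fin 2) R) : Prop :=
  ∀ i k j l, wDiag a b i k • (M i j * M' k l) + wOff c i k • (M k j * M' i l) =
    wDiag a b j l • (M' k l * M i j) + wOff c j l • (M' k j * M i l)

theorem rtt_one {R : Type*} [Ring R] [Algebra ℂ R] (a b c : ℂ) :
    RTT a b c (1 : Matrix (Fin 2) (Fin 2) R) 1 := by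
  intro i k j l
  fin_cases i <;> fin_cases k <;> fin_cases j <;> fin_cases l <;> simp [wDiag, wOff]

/-- The usual train argument: after the mutually commuting entries are regrouped, the `R`-matrix
passes first through the pair `M`, `M'` and then through the pair `K`, `K'`. -/
theorem RTT.mul {R : Type*} [Ring R] [Algebra ℂ R] {a b c : ℂ}
    {M M' K K' : Matrix (Fin 2) (Fin 2) R} (hM : RTT a b c M M') (hK : RTT a b c K K')
    (h₁ : EntriesCommute K M') (h₂ : EntriesCommute M K') :
    RTT a b c (M * K) (M' * K') := by
  intro i k j l
  have e₁ : ∀ i j k l, (M * K) i j * (M' * K') k l =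
      ∑ p, ∑ r, M i p * M' k r * (K p j * K' r l) :=
    h₁.mul_apply_mul_mul_apply
  have e₂ : ∀ i j k l, (M' * K') k l * (M * K) i j =
      ∑ p, ∑ r, M' k r * M i p * (K' r l * K p j) := by
    intro i j k l
    simp only [Matrix.mul_apply, Finset.sum_mul_sum]
    rw [Finset.sum_comm]
    refine Finset.sum_congr rfl fun p _ => Finset.sum_congr rfl fun r _ => ?_
    rw [mul_assoc, ← mul_assoc (K' r l), ← (h₂ i p r l).eq]
    simp only [mul_assoc]
  calc wDiag a b i k • ((M * K) i j * (M' * K') k l) + wOff c i k • ((M * K) k j * (M' * K') i l)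
      = ∑ p, ∑ r, (wDiag a b i k • (M i p * M' k r) + wOff c i k • (M k p * M' i r)) *
          (K p j * K' r l) := by
        simp only [e₁, Finset.smul_sum, ← Finset.sum_add_distrib, add_mul, smul_mul_assoc]
    _ = ∑ p, ∑ r, (wDiag a b p r • (M' k r * M i p) + wOff c p r • (M' k p * M i r)) *
          (K p j * K' r l) := by
        simp only [hM i k]
    -- The off-diagonal terms have the summation indices `p` and `r` exchanged, which transfers the
    -- weights from the first pair to the second.
    _ = ∑ p, ∑ r, M' k r * M i p * (wDiag a b p r • (K p j * K' r l) +
          wOff c p r • (K r j * K' p l)) := by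
        simp only [Fin.sum_univ_two, wDiag, wOff, mul_add, add_mul, smul_mul_assoc,
          mul_smul_comm]
        simp
        abel
    _ = ∑ p, ∑ r, M' k r * M i p * (wDiag a b j l • (K' r l * K p j) +
          wOff c j l • (K' r j * K p l)) := by
        simp only [hK _ _ j l]
    _ = _ := by
        simp only [e₂, Finset.smul_sum, ← Finset.sum_add_distrib, mul_add, mul_smul_comm]

/-- Both indices of the matrix flipped, that is, conjugation by `σˣ`. -/
def flip {R : Type*} (M : Matrix (Fin 2) (Fin 2) R) : Matrix (Fin 2) (Fin 2) R :=
  M.submatrix (· + 1) (· + 1)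

theorem flip_apply {R : Type*} (M : Matrix (Fin 2) (Fin 2) R) (i j : Fin 2) :
    flip M i j = M (i + 1) (j + 1) := rfl

theorem flip_mul {R : Type*} [Ring R] (M M' : Matrix (Fin 2) (Fin 2) R) :
    flip (M * M') = flip M * flip M' := by
  ext i j
  simp only [flip_apply, Matrix.mul_apply, Fin.sum_univ_two, zero_add]
  exact add_comm _ _

theorem flip_one {R : Type*} [Ring R] : flip (1 : Matrix (Fin 2) (Fin 2) R) = 1 := by
  ext i j
  simp [flip_apply, Matrix.one_apply]

/-- The weights only see whether two indices coincide, so the `R`-matrix is invariant under the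
simultaneous spin flip. -/
theorem RTT.flip {R : Type*} [Ring R] [Algebra ℂ R] {a b c : ℂ}
    {M M' : Matrix (Fin 2) (Fin 2) R} (h : RTT a b c M M') :
    RTT a b c (flip M) (flip M') := by
  intro i k j l
  simpa [flip_apply, wDiag, wOff] using h (i + 1) (k + 1) (j + 1) (l + 1)

theorem EntriesCommute.flip_left {R : Type*} [Ring R] {M M' : Matrix (Fin 2) (Fin 2) R}
    (h : EntriesCommute M M') : EntriesCommute (flip M) M' := fun _ _ k l => h _ _ k l

/-- The antiperiodic trace `tr(M σˣ)`. -/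
def antiTrace {R : Type*} [Ring R] (M : Matrix (Fin 2) (Fin 2) R) : R := M 0 1 + M 1 0

/-- Antiperiodic traces of matrices subject to the exchange relation commute. -/
theorem RTT.antiTrace_commute {R : Type*} [Ring R] [Algebra ℂ R] {a b c : ℂ} (ha : a ≠ 0)
    (hbc : b ^ 2 - c ^ 2 ≠ 0) {M M' : Matrix (Fin 2) (Fin 2) R} (h : RTT a b c M M') :
    Commute (antiTrace M) (antiTrace M') := by
  have hB := h 0 0 1 1
  have hC := h 1 1 0 0
  have h₁ := h 0 1 1 0
  have h₂ := h 1 0 0 1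
  have h₃ := h 0 1 0 1
  have h₄ := h 1 0 1 0
  simp only [wDiag, wOff, if_true, zero_smul, add_zero, zero_ne_one, one_ne_zero, if_false]
    at hB hC h₁ h₂ h₃ h₄
  have hB' : M 0 1 * M' 0 1 = M' 0 1 * M 0 1 := smul_right_injective R ha hB
  have hC' : M 1 0 * M' 1 0 = M' 1 0 * M 1 0 := smul_right_injective R ha hC
  -- In `b (h₁ + h₂) - c (h₃ + h₄)` all products of diagonal entries cancel.
  have hX : (b ^ 2 - c ^ 2) • (M 0 1 * M' 1 0 + M 1 0 * M' 0 1) =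
      (b ^ 2 - c ^ 2) • (M' 0 1 * M 1 0 + M' 1 0 * M 0 1) := by
    have h₁' := congrArg (b • ·) h₁
    have h₂' := congrArg (b • ·) h₂
    have h₃' := congrArg (c • ·) h₃
    have h₄' := congrArg (c • ·) h₄
    simp only [smul_add, smul_smul] at h₁' h₂' h₃' h₄'
    have := congrArg₂ (· - ·) (congrArg₂ (· + ·) h₁' h₂') (congrArg₂ (· + ·) h₃' h₄')
    rw [← sub_eq_zero] at this ⊢
    rw [← this]
    module
  have hX' : M 0 1 * M' 1 0 + M 1 0 * M' 0 1 = M' 0 1 * M 1 0 + M' 1 0 * M 0 1 :=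
    smul_right_injective R hbc hX
  change (M 0 1 + M 1 0) * (M' 0 1 + M' 1 0) = (M' 0 1 + M' 1 0) * (M 0 1 + M 1 0)
  calc (M 0 1 + M 1 0) * (M' 0 1 + M' 1 0)
      = M 0 1 * M' 0 1 + M 1 0 * M' 1 0 + (M 0 1 * M' 1 0 + M 1 0 * M' 0 1) := by noncomm_ring
    _ = M' 0 1 * M 0 1 + M' 1 0 * M 1 0 + (M' 0 1 * M 1 0 + M' 1 0 * M 0 1) := by
        rw [hB', hC', hX']
    _ = _ := by noncomm_ring

/-! ### The quantum determinant -/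

/-- The antisymmetric symbol. -/
def eps (i k : Fin 2) : ℂ := if i = k then 0 else if i = 0 then 1 else -1

/-- The pair `M`, `M'` has quantum determinant `s`. -/
def QDet {R : Type*} [Ring R] [Algebra ℂ R] (s : ℂ) (M M' : Matrix (Fin 2) (Fin 2) R) : Prop :=
  ∀ i k, M i 0 * M' k 1 - M i 1 * M' k 0 = (eps i k * s) • (1 : R)

theorem qDet_one {R : Type*} [Ring R] [Algebra ℂ R] :
    QDet 1 (1 : Matrix (Fin 2) (Fin 2) R) 1 := by
  intro i k
  fin_cases i <;> fin_cases k <;> simp [eps, Matrix.one_apply]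

/-- Contracting the columns of the inner pair with the antisymmetric symbol yields that symbol on
its rows, which then contracts the outer pair. -/
theorem QDet.mul {R : Type*} [Ring R] [Algebra ℂ R] {s t : ℂ}
    {M M' K K' : Matrix (Fin 2) (Fin 2) R} (hM : QDet s M M') (hK : QDet t K K')
    (h : EntriesCommute K M') : QDet (s * t) (M * K) (M' * K') := by
  intro i k
  have e : ∀ j l, (M * K) i j * (M' * K') k l =
      ∑ p, ∑ r, M i p * M' k r * (K p j * K' r l) :=
    fun j l => h.mul_apply_mul_mul_apply i j k l
  calc (M * K) i 0 * (M' * K') k 1 - (M * K) i 1 * (M' * K') k 0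
      = ∑ p, ∑ r, M i p * M' k r * (K p 0 * K' r 1 - K p 1 * K' r 0) := by
        simp only [e, ← Finset.sum_sub_distrib, mul_sub]
    _ = ∑ p, ∑ r, M i p * M' k r * ((eps p r * t) • (1 : R)) := by simp only [hK _ _]
    _ = t • (M i 0 * M' k 1 - M i 1 * M' k 0) := by
        simp [Fin.sum_univ_two, eps]
        module
    _ = _ := by
        rw [hM i k, smul_smul]
        congr 1
        ring

/-- Products of entries of `M` and `M'` are antisymmetric in the row indices. -/
def RowAntisymm {R : Type*} [Ring R] (M M' : Matrix (Fin 2) (Fin 2) R) : Prop :=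
  ∀ i j k l, M i j * M' k l = -(M k j * M' i l)

theorem RowAntisymm.mul_right {R : Type*} [Ring R] {M M' K K' : Matrix (Fin 2) (Fin 2) R}
    (hM : RowAntisymm M M') (h : EntriesCommute K M') : RowAntisymm (M * K) (M' * K') := by
  have e : ∀ i j k l, (M * K) i j * (M' * K') k l =
      ∑ p, ∑ r, M i p * M' k r * (K p j * K' r l) :=
    h.mul_apply_mul_mul_apply
  intro i j k l
  rw [e, e]
  simp only [← Finset.sum_neg_distrib]
  refine Finset.sum_congr rfl fun p _ => Finset.sum_congr rfl fun r _ => ?_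
  rw [hM, neg_mul]

theorem RowAntisymm.self_eq_zero {R : Type*} [Ring R] [Algebra ℂ R]
    {M M' : Matrix (Fin 2) (Fin 2) R} (h : RowAntisymm M M') (i j l : Fin 2) :
    M i j * M' i l = 0 := by
  have h2 : (2 : ℂ) • (M i j * M' i l) = 0 := by
    rw [two_smul]
    nth_rewrite 1 [h]
    exact neg_add_cancel _
  exact (smul_eq_zero.mp h2).resolve_left two_ne_zero

/-- Row antisymmetry of the inner pair projects the outer pair onto its quantum determinant, so the
row indices survive only in the antisymmetric symbol. -/
theorem RowAntisymm.mul_left {R : Type*} [Ring R] [Algebra ℂ R] {s : ℂ}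
    {M M' K K' : Matrix (Fin 2) (Fin 2) R}
    (hK : RowAntisymm K K') (hM : QDet s M M') (h : EntriesCommute K M') :
    RowAntisymm (M * K) (M' * K') := by
  have e : ∀ i j k l, (M * K) i j * (M' * K') k l = (eps i k * s) • (K 0 j * K' 1 l) := by
    intro i j k l
    rw [h.mul_apply_mul_mul_apply, ← one_mul (K 0 j * K' 1 l), ← smul_mul_assoc, ← hM i k]
    simp only [Fin.sum_univ_two, hK.self_eq_zero, hK 1 j 0 l]
    noncomm_ring
  intro i j k l
  rw [e, e, ← neg_smul]
  congr 1
  fin_cases i <;> fin_cases k <;> simp [eps]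

/-! ### Matrix units commuting with a two by two matrix -/

/-- The Lax matrix with weights `a`, `b`, `c` built on a family of matrix units. -/
def unitLax {R : Type*} [Ring R] [Algebra ℂ R] (a b c : ℂ) (e : Fin 2 → Fin 2 → R) :
    Matrix (Fin 2) (Fin 2) R :=
  !![a • e 0 0 + b • e 1 1, c • e 1 0; c • e 0 1, b • e 0 0 + a • e 1 1]

theorem commute_unitLax {R : Type*} [Ring R] [Algebra ℂ R] {e : Fin 2 → Fin 2 → R} {x : R}
    (h : ∀ i j, Commute x (e i j)) (a b c : ℂ) (k l : Fin 2) :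
    Commute x (unitLax a b c e k l) := by
  have hd : ∀ a b : ℂ, Commute x (a • e 0 0 + b • e 1 1) := fun a b =>
    ((h 0 0).smul_right a).add_right ((h 1 1).smul_right b)
  fin_cases k <;> fin_cases l
  · exact hd a b
  · exact (h 1 0).smul_right c
  · exact (h 0 1).smul_right c
  · exact hd b a

theorem unitLax_rtt {R : Type*} [Ring R] [Algebra ℂ R] {e : Fin 2 → Fin 2 → R}
    (he : ∀ i j k l, e i j * e k l = if j = k then e i l else 0) {q u v : ℂ}
    (hq : q ≠ 0) (hu : u ≠ 0) (hv : v ≠ 0) :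
    RTT (u / v * q - (u / v * q)⁻¹) (u / v - (u / v)⁻¹) (q - q⁻¹)
      (unitLax (u * q - (q * u)⁻¹) (u - u⁻¹) (q - q⁻¹) e)
      (unitLax (v * q - (q * v)⁻¹) (v - v⁻¹) (q - q⁻¹) e) := by
  intro i k j l
  fin_cases i <;> fin_cases k <;> fin_cases j <;> fin_cases l <;>
    simp [unitLax, wDiag, wOff, mul_add, add_mul, he, smul_smul] <;>
    match_scalars <;> field_simp <;> ring

theorem unitLax_qDet {R : Type*} [Ring R] [Algebra ℂ R] {e : Fin 2 → Fin 2 → R}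
    (he : ∀ i j k l, e i j * e k l = if j = k then e i l else 0) (he₁ : e 0 0 + e 1 1 = 1)
    {q u : ℂ} (hq : q ≠ 0) (hu : u ≠ 0) :
    QDet ((u * q - (q * u)⁻¹) * (u / q - (u / q)⁻¹))
      (unitLax (u * q - (q * u)⁻¹) (u - u⁻¹) (q - q⁻¹) e)
      (unitLax (u / q * q - (q * (u / q))⁻¹) (u / q - (u / q)⁻¹) (q - q⁻¹) e) := by
  intro i k
  -- Writing 1 as the sum of the diagonal units leaves only linear combinations of matrix units to
  -- compare.
  rw [← he₁]
  fin_cases i <;> fin_cases k <;>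
    simp [unitLax, eps, mul_add, add_mul, he, smul_smul] <;>
    match_scalars <;> field_simp <;> ring

/-- These are the Lax matrices at 1 and `q⁻¹`: the first is a multiple of the permutation, the
second degenerates to an antisymmetric tensor. -/
theorem unitLax_rowAntisymm {R : Type*} [Ring R] [Algebra ℂ R] {e : Fin 2 → Fin 2 → R}
    (he : ∀ i j k l, e i j * e k l = if j = k then e i l else 0) (c : ℂ) :
    RowAntisymm (unitLax c 0 c e) (unitLax 0 (-c) c e) := by
  intro i j k l
  fin_cases i <;> fin_cases k <;> fin_cases j <;> fin_cases l <;>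
    simp [unitLax, he, smul_smul]

/-- One step of the shift. The exchange weights are those of the Lax matrix being moved, so both
sides become one expression in the matrix units, written before and after a single use of the
exchange relation. The `σˣ` in the trace shifts the unit index to `r + 1` and so produces the flip.
-/
theorem antiTrace_mul_unitLax {R : Type*} [Ring R] [Algebra ℂ R] {e : Fin 2 → Fin 2 → R}
    (he : ∀ i j k l, e i j * e k l = if j = k then e i l else 0)
    {Z Z' : Matrix (Fin 2) (Fin 2) R} (hZ : ∀ i j k l, Z i j * e k l = e k l * Z i j)
    (hZ' : ∀ i j k l, Z' i j * e k l = e k l * Z' i j) {a b c : ℂ} (d : ℂ)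
    (h : RTT a b c Z Z') (i j : Fin 2) :
    antiTrace (Z' * unitLax d 0 d e) * (Z * unitLax a b c e) i j =
      (flip (unitLax a b c e) * Z) i j * antiTrace (Z' * unitLax d 0 d e) := by
  have he' : ∀ i j k l x, e i j * (e k l * x) = if j = k then e i l * x else 0 := by
    intro i j k l x
    rw [← mul_assoc, he]
    split_ifs <;> simp
  have hZx : ∀ i j k l x, Z i j * (e k l * x) = e k l * (Z i j * x) := by
    intro i j k l x
    rw [← mul_assoc, hZ, mul_assoc]
  have hZx' : ∀ i j k l x, Z' i j * (e k l * x) = e k l * (Z' i j * x) := by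
    intro i j k l x
    rw [← mul_assoc, hZ', mul_assoc]
  calc antiTrace (Z' * unitLax d 0 d e) * (Z * unitLax a b c e) i j
      = ∑ r, ∑ l, d • (e (r + 1) l * (wDiag a b j l • (Z' r l * Z i j) +
          wOff c j l • (Z' r j * Z i l))) := by
        fin_cases i <;> fin_cases j <;>
          simp [antiTrace, unitLax, wDiag, wOff, Matrix.mul_apply, Fin.sum_univ_two, mul_add,
            add_mul, mul_assoc, he', hZ, hZ', hZx'] <;> module
    _ = ∑ r, ∑ l, d • (e (r + 1) l * (wDiag a b i r • (Z i j * Z' r l) +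
          wOff c i r • (Z r j * Z' i l))) := by
        simp only [h _ _ _ _]
    _ = _ := by
        fin_cases i <;> fin_cases j <;>
          simp [antiTrace, unitLax, wDiag, wOff, Matrix.mul_apply, Fin.sum_univ_two, mul_add,
            add_mul, mul_assoc, he', hZ', hZx, flip_apply] <;> module

/-- The twisted trace `tr(M X σˣ)`. -/
def twistTrace {R : Type*} [Ring R] [Algebra ℂ R] (X : Matrix (Fin 2) (Fin 2) ℂ)
    (M : Matrix (Fin 2) (Fin 2) R) : R :=
  X 0 1 • M 0 0 + X 1 1 • M 0 1 + X 0 0 • M 1 0 + X 1 0 • M 1 1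

/-- `unitLax d 0 d e` is `d` times the permutation, which carries the auxiliary `X` to the site;
there it commutes with `Z` and leaves the trace on the left. -/
theorem twistTrace_mul_unitLax {R : Type*} [Ring R] [Algebra ℂ R] {e : Fin 2 → Fin 2 → R}
    (he : ∀ i j k l, e i j * e k l = if j = k then e i l else 0)
    {Z : Matrix (Fin 2) (Fin 2) R} (hZ : ∀ i j k l, Z i j * e k l = e k l * Z i j) (d : ℂ)
    (X : Matrix (Fin 2) (Fin 2) ℂ) :
    twistTrace X (Z * unitLax d 0 d e) =
      (∑ i, ∑ j, X i j • e i j) * antiTrace (Z * unitLax d 0 d e) := by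
  have he' : ∀ i j k l x, e i j * (e k l * x) = if j = k then e i l * x else 0 := by
    intro i j k l x
    rw [← mul_assoc, he]
    split_ifs <;> simp
  simp [twistTrace, antiTrace, unitLax, Matrix.mul_apply, Fin.sum_univ_two, mul_add,
    add_mul, he', hZ]
  module

/-- The trace `tr(σᶻ Mᵗ σᶻ X σˣ)`. -/
def cotwistTrace {R : Type*} [Ring R] [Algebra ℂ R] (X : Matrix (Fin 2) (Fin 2) ℂ)
    (M : Matrix (Fin 2) (Fin 2) R) : R :=
  X 0 1 • M 0 0 - X 1 1 • M 1 0 - X 0 0 • M 0 1 + X 1 0 • M 1 1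

/-- Equal-row products vanish, and swapping rows in the others moves `X` from the second factor to
the first. This links the two reconstruction formulas. -/
theorem RowAntisymm.antiTrace_mul_cotwistTrace {R : Type*} [Ring R] [Algebra ℂ R]
    {M M' : Matrix (Fin 2) (Fin 2) R} (h : RowAntisymm M M') (X : Matrix (Fin 2) (Fin 2) ℂ) :
    antiTrace M * cotwistTrace X M' = -(twistTrace X M * antiTrace M') := by
  simp [antiTrace, cotwistTrace, twistTrace, mul_add, add_mul, mul_sub, h.self_eq_zero,
    h 1 _ 0 _]
  module

theorem RowAntisymm.antiTrace_mul_antiTrace {R : Type*} [Ring R] [Algebra ℂ R]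
    {M M' : Matrix (Fin 2) (Fin 2) R} (h : RowAntisymm M M') :
    antiTrace M * antiTrace M' = M 0 1 * M' 1 0 - M 0 0 * M' 1 1 := by
  simp [antiTrace, mul_add, add_mul, h.self_eq_zero, h 1 _ 0 _]
  abel

/-! ### Local operators -/

theorem localOp_add {N : ℕ} (n : Fin N) (X Y : Matrix (Fin 2) (Fin 2) ℂ) :
    localOp n (X + Y) = localOp n X + localOp n Y := by
  ext s t
  simp only [localOp, Matrix.add_apply]
  split_ifs <;> simp

theorem localOp_smul {N : ℕ} (n : Fin N) (c : ℂ) (X : Matrix (Fin 2) (Fin 2) ℂ) :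
    localOp n (c • X) = c • localOp n X := by
  ext s t
  simp only [localOp, Matrix.smul_apply]
  split_ifs <;> simp

theorem localOp_one {N : ℕ} (n : Fin N) : localOp n 1 = 1 := by
  ext s t
  by_cases h : s = t
  · subst h
    simp [localOp]
  · rw [Matrix.one_apply_ne h]
    simp only [localOp]
    split_ifs with h'
    · refine Matrix.one_apply_ne fun hn => h (funext fun m => ?_)
      by_cases hm : m = n
      · rw [hm, hn]
      · exact h' m hm
    · rfl

theorem localOp_mul {N : ℕ} (n : Fin N) (X Y : Matrix (Fin 2) (Fin 2) ℂ) :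
    localOp n X * localOp n Y = localOp n (X * Y) := by
  ext s t
  rw [Matrix.mul_apply]
  simp only [localOp]
  split_ifs with h
  · rw [Matrix.mul_apply, ← Finset.sum_subset (Finset.subset_univ
      (Finset.univ.image fun v => Function.update s n v))]
    · rw [Finset.sum_image fun v _ w _ hvw => Function.update_injective s n hvw]
      refine Finset.sum_congr rfl fun v _ => ?_
      rw [if_pos fun m hm => by simp [hm], if_pos fun m hm => by simp [hm, h m hm]]
      simp
    · intro u _ hu
      rw [if_neg, zero_mul]
      intro h'
      refine hu (Finset.mem_image.mpr ⟨u n, Finset.mem_univ _, funext fun m => ?_⟩)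
      by_cases hm : m = n
      · subst hm
        simp
      · simp [hm, h' m hm]
  · refine Finset.sum_eq_zero fun u _ => ?_
    by_cases h₁ : ∀ m, m ≠ n → s m = u m
    · rw [if_neg (c := ∀ m, m ≠ n → u m = t m)
        (fun h₂ => h fun m hm => (h₁ m hm).trans (h₂ m hm)), mul_zero]
    · rw [if_neg h₁, zero_mul]

/-- Only the intermediate configuration `s` updated at `n` contributes; the resulting formula is
symmetric in the two sites, whence commutation. -/
theorem localOp_mul_apply_of_ne {N : ℕ} {n m : Fin N} (hnm : n ≠ m)
    (X Y : Matrix (Fin 2) (Fin 2) ℂ) (s t : Fin N → Fin 2) :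
    (localOp n X * localOp m Y) s t =
      if ∀ k, k ≠ n → k ≠ m → s k = t k then X (s n) (t n) * Y (s m) (t m) else 0 := by
  rw [Matrix.mul_apply, Finset.sum_eq_single (Function.update s n (t n))]
  · simp only [localOp]
    rw [if_pos fun k hk => by simp [hk]]
    simp only [Function.update_self, Function.update_of_ne hnm.symm]
    by_cases h : ∀ k, k ≠ n → k ≠ m → s k = t k
    · rw [if_pos h, if_pos]
      intro k hk
      by_cases hkn : k = n
      · subst hkn
        simp
      · simp [hkn, h k hkn hk]
    · rw [if_neg h, if_neg, mul_zero]
      intro h'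
      refine h fun k hkn hkm => ?_
      simpa [hkn] using h' k hkm
  · intro u _ hu
    simp only [localOp]
    by_cases h₁ : ∀ k, k ≠ n → s k = u k
    · rw [if_neg (c := ∀ k, k ≠ m → u k = t k), mul_zero]
      intro h₂
      refine hu (funext fun k => ?_)
      by_cases hk : k = n
      · subst hk
        simp [h₂ k hnm]
      · simp [hk, h₁ k hk]
    · rw [if_neg h₁, zero_mul]
  · simp

theorem localOp_commute {N : ℕ} {n m : Fin N} (hnm : n ≠ m) (X Y : Matrix (Fin 2) (Fin 2) ℂ) :
    Commute (localOp n X) (localOp m Y) := by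
  ext s t
  rw [localOp_mul_apply_of_ne hnm, localOp_mul_apply_of_ne hnm.symm, mul_comm]
  refine if_congr ?_ rfl rfl
  exact forall_congr' fun k => ⟨fun h h₁ h₂ => h h₂ h₁, fun h h₁ h₂ => h h₂ h₁⟩

/-- The matrix unit `E_{ij}` at site `n`. -/
def siteUnit {N : ℕ} (n : Fin N) (i j : Fin 2) : Op N := localOp n (Matrix.single i j 1)

theorem siteUnit_mul {N : ℕ} (n : Fin N) (i j k l : Fin 2) :
    siteUnit n i j * siteUnit n k l = if j = k then siteUnit n i l else 0 := by
  rw [siteUnit, siteUnit, localOp_mul]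
  split_ifs with h
  · subst h
    simp [siteUnit]
  · rw [Matrix.single_mul_single_of_ne _ _ _ _ h]
    ext s t
    simp [localOp]

theorem sum_smul_siteUnit {N : ℕ} (n : Fin N) (X : Matrix (Fin 2) (Fin 2) ℂ) :
    ∑ i, ∑ j, X i j • siteUnit n i j = localOp n X := by
  have h : X = X 0 0 • Matrix.single 0 0 1 + X 0 1 • Matrix.single 0 1 1 +
      (X 1 0 • Matrix.single 1 0 1 + X 1 1 • Matrix.single 1 1 1) := by
    ext i j
    fin_cases i <;> fin_cases j <;> simp
  conv_rhs => rw [h]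
  simp only [localOp_add, localOp_smul, Fin.sum_univ_two, siteUnit]

theorem siteUnit_add {N : ℕ} (n : Fin N) : siteUnit n 0 0 + siteUnit n 1 1 = 1 := by
  rw [← localOp_one n, ← sum_smul_siteUnit]
  simp [Fin.sum_univ_two]

theorem lax_eq_unitLax {N : ℕ} (q : ℂ) (n : Fin N) (u : ℂ) :
    lax q n u = unitLax (u * q - (q * u)⁻¹) (u - u⁻¹) (q - q⁻¹) (siteUnit n) := by
  have hz : localOp n sigmaZ = siteUnit n 0 0 - siteUnit n 1 1 := by
    rw [← sum_smul_siteUnit]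
    simp [Fin.sum_univ_two, sigmaZ, sub_eq_add_neg]
  have hp : localOp n sigmaPlus = siteUnit n 0 1 := by
    rw [← sum_smul_siteUnit]
    simp [Fin.sum_univ_two, sigmaPlus]
  have hm : localOp n sigmaMinus = siteUnit n 1 0 := by
    rw [← sum_smul_siteUnit]
    simp [Fin.sum_univ_two, sigmaMinus]
  rw [lax, unitLax, hz, hp, hm, ← siteUnit_add n, xPlus, xMinus]
  refine Matrix.ext fun i j => ?_
  fin_cases i <;> fin_cases j <;> simp <;> module

theorem siteUnit_commute_unitLax {N : ℕ} {n m : Fin N} (h : n ≠ m) (a b c : ℂ)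
    (i j k l : Fin 2) : Commute (siteUnit n i j) (unitLax a b c (siteUnit m) k l) :=
  commute_unitLax (fun _ _ => localOp_commute h _ _) a b c k l

theorem entriesCommute_unitLax {N : ℕ} {n m : Fin N} (h : n ≠ m) (a b c a' b' c' : ℂ) :
    EntriesCommute (unitLax a b c (siteUnit n)) (unitLax a' b' c' (siteUnit m)) :=
  fun i j k l => (commute_unitLax
    (fun i' j' => (siteUnit_commute_unitLax h a' b' c' i' j' k l).symm) a b c i j).symm

/-! ### Partial monodromy matrices -/

/-- The product of the Lax matrices over a list of sites. -/
noncomputable def mono {N : ℕ} (q : ℂ) (η : Fin N → ℂ) (l : List (Fin N)) (z : ℂ) : AuxOp N :=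
  (l.map fun n => lax q n (z / η n)).prod

theorem mono_nil {N : ℕ} (q : ℂ) (η : Fin N → ℂ) (z : ℂ) : mono q η [] z = 1 := rfl

theorem mono_cons {N : ℕ} (q : ℂ) (η : Fin N → ℂ) (n : Fin N) (l : List (Fin N)) (z : ℂ) :
    mono q η (n :: l) z = lax q n (z / η n) * mono q η l z := by
  simp [mono]

theorem mono_append {N : ℕ} (q : ℂ) (η : Fin N → ℂ) (l l' : List (Fin N)) (z : ℂ) :
    mono q η (l ++ l') z = mono q η l z * mono q η l' z := by
  simp [mono]

theorem entriesCommute_lax_mono {N : ℕ} (q : ℂ) (η : Fin N → ℂ) {n : Fin N} {l : List (Fin N)}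
    (h : n ∉ l) (u z : ℂ) : EntriesCommute (lax q n u) (mono q η l z) := by
  induction l with
  | nil => exact (entriesCommute_one_left _).symm
  | cons m l ih =>
    rw [List.mem_cons, not_or] at h
    rw [mono_cons]
    refine EntriesCommute.mul_right ?_ (ih h.2)
    rw [lax_eq_unitLax, lax_eq_unitLax]
    exact entriesCommute_unitLax h.1 _ _ _ _ _ _

theorem entriesCommute_mono {N : ℕ} (q : ℂ) (η : Fin N → ℂ) {l l' : List (Fin N)}
    (h : l.Disjoint l') (z z' : ℂ) : EntriesCommute (mono q η l z) (mono q η l' z') := by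
  induction l with
  | nil => exact entriesCommute_one_left _
  | cons m l ih =>
    rw [List.disjoint_cons_left] at h
    rw [mono_cons]
    exact (entriesCommute_lax_mono q η h.1 _ _).mul_left (ih h.2)

theorem siteUnit_commute_mono {N : ℕ} (q : ℂ) (η : Fin N → ℂ) {n : Fin N} {l : List (Fin N)}
    (h : n ∉ l) (i j k m : Fin 2) (z : ℂ) : Commute (siteUnit n i j) (mono q η l z k m) := by
  induction l generalizing k with
  | nil =>
    rw [mono_nil, Matrix.one_apply]
    split_ifs
    · exact Commute.one_right _
    · exact Commute.zero_right _
  | cons p l ih =>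
    rw [List.mem_cons, not_or] at h
    rw [mono_cons, Matrix.mul_apply, lax_eq_unitLax]
    exact Commute.sum_right _ _ _ fun r _ =>
      (siteUnit_commute_unitLax h.1 _ _ _ _ _ _ _).mul_right (ih h.2 _)

theorem rtt_mono {N : ℕ} {q : ℂ} (hq : q ≠ 0) {η : Fin N → ℂ} (hη : ∀ b, η b ≠ 0)
    {l : List (Fin N)} (hl : l.Nodup) {z w : ℂ} (hz : z ≠ 0) (hw : w ≠ 0) :
    RTT (z / w * q - (z / w * q)⁻¹) (z / w - (z / w)⁻¹) (q - q⁻¹) (mono q η l z)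
      (mono q η l w) := by
  induction l with
  | nil => exact rtt_one _ _ _
  | cons n l ih =>
    rw [List.nodup_cons] at hl
    rw [mono_cons, mono_cons]
    refine RTT.mul ?_ (ih hl.2) (entriesCommute_lax_mono q η hl.1 _ _).symm
      (entriesCommute_lax_mono q η hl.1 _ _)
    have := unitLax_rtt (siteUnit_mul n) hq (div_ne_zero hz (hη n)) (div_ne_zero hw (hη n))
    rwa [div_div_div_cancel_right₀ (hη n), ← lax_eq_unitLax, ← lax_eq_unitLax] at this

theorem qDet_mono {N : ℕ} {q : ℂ} (hq : q ≠ 0) {η : Fin N → ℂ} (hη : ∀ b, η b ≠ 0)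
    {l : List (Fin N)} (hl : l.Nodup) {z : ℂ} (hz : z ≠ 0) :
    QDet (l.map fun n => (z * q / η n - η n / (z * q)) * (z / q / η n - η n / (z / q))).prod
      (mono q η l z) (mono q η l (z / q)) := by
  induction l with
  | nil => exact qDet_one
  | cons n l ih =>
    rw [List.nodup_cons] at hl
    rw [mono_cons, mono_cons, List.map_cons, List.prod_cons]
    refine QDet.mul ?_ (ih hl.2) (entriesCommute_lax_mono q η hl.1 _ _).symm
    have := unitLax_qDet (siteUnit_mul n) (siteUnit_add n) hq (div_ne_zero hz (hη n))
    rw [← lax_eq_unitLax, ← lax_eq_unitLax, div_right_comm] at this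
    convert this using 2
    · have := hη n
      field_simp
    · have := hη n
      field_simp

theorem lax_one {N : ℕ} (q : ℂ) (n : Fin N) :
    lax q n 1 = unitLax (q - q⁻¹) 0 (q - q⁻¹) (siteUnit n) := by
  simp [lax_eq_unitLax]

theorem rowAntisymm_mono {N : ℕ} {q : ℂ} (hq : q ≠ 0) {η : Fin N → ℂ} (hη : ∀ b, η b ≠ 0)
    {l₁ l₂ : List (Fin N)} {n : Fin N} (hl : (l₁ ++ n :: l₂).Nodup) :
    RowAntisymm (mono q η (l₁ ++ n :: l₂) (η n)) (mono q η (l₁ ++ n :: l₂) (η n / q)) := by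
  rw [List.nodup_append'] at hl
  rw [mono_append, mono_append, mono_cons, mono_cons]
  have hd := List.disjoint_cons_right.mp hl.2.2
  have hn := List.nodup_cons.mp hl.2.1
  refine RowAntisymm.mul_left (RowAntisymm.mul_right ?_ ?_) (qDet_mono hq hη hl.1 (hη n)) ?_
  · rw [div_right_comm, div_self (hη n), lax_one]
    convert unitLax_rowAntisymm (siteUnit_mul n) (q - q⁻¹) using 1
    -- At `q⁻¹` the diagonal weights are 0 and `-(q - q⁻¹)`.
    rw [lax_eq_unitLax]
    congr 1
    · field_simp
      simp
    · field_simp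
      ring
  · exact (entriesCommute_lax_mono q η hn.1 _ _).symm
  · exact (entriesCommute_lax_mono q η hd.1 _ _).mul_left (entriesCommute_mono q η hd.2.symm _ _)

/-! ### The shift property -/

theorem lax_flip_shift {N : ℕ} {q : ℂ} (hq : q ≠ 0) {η : Fin N → ℂ} (hη : ∀ b, η b ≠ 0)
    {l₁ l₂ : List (Fin N)} {n : Fin N} (hl₁ : l₁.Nodup) (hl₂ : l₂.Nodup) (h : l₁.Disjoint l₂)
    (hn₁ : n ∉ l₁) (hn₂ : n ∉ l₂) {z : ℂ} (hz : z ≠ 0) (i j : Fin 2) :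
    antiTrace (flip (mono q η l₁ (η n)) * mono q η l₂ (η n) * lax q n 1) *
        (flip (mono q η l₁ z) * mono q η l₂ z * lax q n (z / η n)) i j =
      (flip (lax q n (z / η n)) * (flip (mono q η l₁ z) * mono q η l₂ z)) i j *
        antiTrace (flip (mono q η l₁ (η n)) * mono q η l₂ (η n) * lax q n 1) := by
  have hc : ∀ w i j k l, (flip (mono q η l₁ w) * mono q η l₂ w) i j * siteUnit n k l =
      siteUnit n k l * (flip (mono q η l₁ w) * mono q η l₂ w) i j := by
    intro w i j k l
    rw [Matrix.mul_apply]
    exact (Commute.sum_right _ _ _ fun r _ => (siteUnit_commute_mono q η hn₁ _ _ _ _ _).mul_right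
      (siteUnit_commute_mono q η hn₂ _ _ _ _ _)).symm.eq
  -- The exchange relation is taken at `z` and `η n`; its weights depend on `z / η n`, exactly the
  -- argument of the Lax matrix at site `n`.
  rw [lax_one, lax_eq_unitLax]
  refine antiTrace_mul_unitLax (siteUnit_mul n) (hc _) (hc _) _ ?_ i j
  have := (rtt_mono hq hη hl₁ hz (hη n)).flip.mul (rtt_mono hq hη hl₂ hz (hη n))
    (entriesCommute_mono q η h _ _).flip_left.symm (entriesCommute_mono q η h _ _).flip_left
  convert this using 2
  rw [mul_comm q]

theorem mono_reverse_shift {N : ℕ} {q : ℂ} (hq : q ≠ 0) {η : Fin N → ℂ} (hη : ∀ b, η b ≠ 0)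
    {L : List (Fin N)} (hL : L.Nodup) (l₁ : List (Fin N)) :
    ∀ l₂ : List (Fin N), l₁ ++ l₂ = L → ∀ {z : ℂ}, z ≠ 0 → ∀ i j : Fin 2,
      (l₁.map fun b => antiTrace (mono q η L.reverse (η b))).prod * mono q η L.reverse z i j =
        (flip (mono q η l₁.reverse z) * mono q η l₂.reverse z) i j *
          (l₁.map fun b => antiTrace (mono q η L.reverse (η b))).prod := by
  -- Sites are appended at the end, since the new transfer matrix stands next to the monodromy
  -- matrix. All `l₂` and `z` are kept general: the hypothesis is used at `η n` to carry the earlier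
  -- product past the new transfer matrix, and at `z` for the monodromy itself.
  induction l₁ using List.reverseRecOn with
  | nil =>
    rintro l₂ rfl z - i j
    simp [mono_nil, flip_one]
  | append_singleton l₁ n ih =>
    intro l₂ h z hz i j
    have h' : l₁ ++ n :: l₂ = L := by rw [← h]; simp
    have hN := hL
    rw [← h', List.nodup_append'] at hN
    have hn := List.nodup_cons.mp hN.2.1
    have hd := List.disjoint_cons_right.mp hN.2.2
    have ih' := fun {w : ℂ} (hw : w ≠ 0) => ih (n :: l₂) h' hw
    simp only [List.reverse_cons, mono_append, mono_cons, mono_nil, mul_one, ← mul_assoc] at ih'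
    have hT := lax_flip_shift hq hη (List.nodup_reverse.mpr hN.1) (List.nodup_reverse.mpr hn.2)
      (by simpa using hd.2) (by simpa using hd.1) (by simpa using hn.1) hz i j
    rw [← div_self (hη n)] at hT
    rw [List.map_append, List.prod_append, List.map_singleton, List.prod_singleton]
    set P := (l₁.map fun b => antiTrace (mono q η L.reverse (η b))).prod
    have hP : P * antiTrace (mono q η L.reverse (η n)) =
        antiTrace (flip (mono q η l₁.reverse (η n)) * mono q η l₂.reverse (η n) *
          lax q n (η n / η n)) * P := by
      simp only [antiTrace, mul_add, add_mul, ih' (hη n)]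
    rw [hP, mul_assoc, ih' hz, ← mul_assoc, hT, mul_assoc]
    simp [mono_cons, flip_mul, mul_assoc]

theorem prod_mul_twistTrace {N : ℕ} {q : ℂ} (hq : q ≠ 0) {η : Fin N → ℂ} (hη : ∀ b, η b ≠ 0)
    {l₁ l₂ : List (Fin N)} {n : Fin N} {L : List (Fin N)} (h : l₁ ++ n :: l₂ = L) (hL : L.Nodup)
    (X : Matrix (Fin 2) (Fin 2) ℂ) :
    (l₁.map fun b => antiTrace (mono q η L.reverse (η b))).prod *
        twistTrace X (mono q η L.reverse (η n)) =
      localOp n X * ((l₁.map fun b => antiTrace (mono q η L.reverse (η b))).prod *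
        antiTrace (mono q η L.reverse (η n))) := by
  have hN := hL
  rw [← h, List.nodup_append'] at hN
  have hn := List.nodup_cons.mp hN.2.1
  have hd := List.disjoint_cons_right.mp hN.2.2
  have hs := mono_reverse_shift hq hη hL l₁ (n :: l₂) h (hη n)
  simp only [List.reverse_cons, mono_append, mono_cons, mono_nil, mul_one, ← mul_assoc,
    div_self (hη n), lax_one] at hs
  have hc : ∀ i j k l, (flip (mono q η l₁.reverse (η n)) * mono q η l₂.reverse (η n)) i j *
      siteUnit n k l =
      siteUnit n k l * (flip (mono q η l₁.reverse (η n)) * mono q η l₂.reverse (η n)) i j := by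
    intro i j k l
    rw [Matrix.mul_apply]
    exact (Commute.sum_right _ _ _ fun r _ =>
      (siteUnit_commute_mono q η (by simpa using hd.1) _ _ _ _ _).mul_right
      (siteUnit_commute_mono q η (by simpa using hn.1) _ _ _ _ _)).symm.eq
  have ht := twistTrace_mul_unitLax (siteUnit_mul n) hc (q - q⁻¹) X
  rw [sum_smul_siteUnit] at ht
  set P := (l₁.map fun b => antiTrace (mono q η L.reverse (η b))).prod
  set K := flip (mono q η l₁.reverse (η n)) * mono q η l₂.reverse (η n) *
    unitLax (q - q⁻¹) 0 (q - q⁻¹) (siteUnit n)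
  have h₁ : P * twistTrace X (mono q η L.reverse (η n)) = twistTrace X K * P := by
    simp only [twistTrace, mul_add, add_mul, mul_smul_comm, smul_mul_assoc, hs]
  have h₂ : P * antiTrace (mono q η L.reverse (η n)) = antiTrace K * P := by
    simp only [antiTrace, mul_add, add_mul, hs]
  rw [h₁, h₂, ht, mul_assoc]

/-! ### Ordered lists of sites -/

theorem filter_split {N : ℕ} (n : Fin N) : ∀ l : List (Fin N), l.Pairwise (· < ·) → n ∈ l →
    l = l.filter (· < n) ++ n :: l.filter (n < ·) ∧
      l.filter (· ≤ n) = l.filter (· < n) ++ [n] := by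
  intro l
  induction l with
  | nil => simp
  | cons m l ih =>
    intro hl hn
    rw [List.pairwise_cons] at hl
    rcases List.mem_cons.mp hn with rfl | hn
    · have h₁ : l.filter (· < n) = [] :=
        List.filter_eq_nil_iff.mpr fun b hb => by simpa using (hl.1 b hb).le
      have h₂ : l.filter (· ≤ n) = [] :=
        List.filter_eq_nil_iff.mpr fun b hb => by simpa using hl.1 b hb
      have h₃ : l.filter (n < ·) = l :=
        List.filter_eq_self.mpr fun b hb => by simpa using hl.1 b hb
      simp [h₁, h₂, h₃]
    · have hm := hl.1 n hn
      obtain ⟨h₁, h₂⟩ := ih hl.2 hn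
      constructor
      · conv_lhs => rw [h₁]
        simp [hm, hm.not_gt]
      · simp [hm, hm.le, h₂]

theorem prodLE_eq {N : ℕ} (n : Fin N) (F : Fin N → Op N) : prodLE n F = prodLT n F * F n := by
  rw [prodLE, prodLT, (filter_split n _ (List.pairwise_lt_finRange N) (List.mem_finRange n)).2]
  simp

/-- Both products run in the same order, so the factors do not telescope directly; commutativity of
the `F b` brings each next to its right inverse. -/
theorem list_prod_mul_prod {ι R : Type*} [Ring R] (F G : ι → R) (l : List ι)
    (hFG : ∀ b ∈ l, F b * G b = 1) (hF : ∀ b ∈ l, ∀ c ∈ l, Commute (F b) (F c)) :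
    (l.map F).prod * (l.map G).prod = 1 := by
  induction l with
  | nil => simp
  | cons b l ih =>
    have hc : Commute (F b) (l.map F).prod := by
      refine Commute.list_prod_right _ _ fun x hx => ?_
      obtain ⟨c, hc, rfl⟩ := List.mem_map.mp hx
      exact hF b List.mem_cons_self c (List.mem_cons_of_mem _ hc)
    rw [List.map_cons, List.map_cons, List.prod_cons, List.prod_cons, hc.eq, mul_assoc,
      ← mul_assoc (F b), hFG b List.mem_cons_self, one_mul]
    exact ih (fun c hc => hFG c (List.mem_cons_of_mem _ hc))
      fun c hc d hd => hF c (List.mem_cons_of_mem _ hc) d (List.mem_cons_of_mem _ hd)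

/-! ### The monodromy matrix of the full chain -/

theorem monodromy_eq_mono {N : ℕ} (q : ℂ) (η : Fin N → ℂ) (z : ℂ) :
    monodromy q η z = mono q η (List.finRange N).reverse z := rfl

theorem antiT_eq {N : ℕ} (q : ℂ) (η : Fin N → ℂ) (z : ℂ) :
    antiT q η z = antiTrace (monodromy q η z) := rfl

theorem trace_mul_auxOp {N : ℕ} (X : Matrix (Fin 2) (Fin 2) ℂ) (M : AuxOp N) :
    Matrix.trace (M * auxOp N X * auxOp N sigmaX) = twistTrace X M := by
  simp [Matrix.trace, Matrix.mul_apply, Fin.sum_univ_two, auxOp, sigmaX, twistTrace]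
  abel

theorem trace_transpose_mul_auxOp {N : ℕ} (X : Matrix (Fin 2) (Fin 2) ℂ) (M : AuxOp N) :
    Matrix.trace (auxOp N sigmaZ * M.transpose * auxOp N sigmaZ * auxOp N X * auxOp N sigmaX) =
      cotwistTrace X M := by
  simp [Matrix.trace, Matrix.mul_apply, Fin.sum_univ_two, auxOp, sigmaX, sigmaZ, cotwistTrace]
  abel

theorem detMbar_eq_neg {N : ℕ} (q : ℂ) (η : Fin N → ℂ) (z : ℂ) :
    detMbar q η z = -detM q η z := by
  rw [detMbar, detM, neg_sub]

theorem detM_eq {N : ℕ} {q : ℂ} (hq : q ≠ 0) {η : Fin N → ℂ} (hη : ∀ b, η b ≠ 0) {z : ℂ}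
    (hz : z ≠ 0) : detM q η z = (-(aCoeff q η z * dCoeff η (z / q))) • (1 : Op N) := by
  have h := qDet_mono hq hη (List.nodup_reverse.mpr (List.nodup_finRange N)) hz 0 1
  rw [List.map_reverse, List.prod_reverse, ← List.ofFn_eq_map, List.prod_ofFn,
    Finset.prod_mul_distrib] at h
  rw [detM, opA, opB, opC, opD]
  simp only [monodromy_eq_mono]
  rw [h]
  simp [eps, aCoeff, dCoeff]

theorem rowAntisymm_monodromy {N : ℕ} {q : ℂ} (hq : q ≠ 0) {η : Fin N → ℂ} (hη : ∀ b, η b ≠ 0)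
    (b : Fin N) : RowAntisymm (monodromy q η (η b)) (monodromy q η (η b / q)) := by
  have hs := (filter_split b _ (List.pairwise_lt_finRange N) (List.mem_finRange b)).1
  have hn := List.nodup_reverse.mpr (List.nodup_finRange N)
  rw [monodromy_eq_mono, monodromy_eq_mono]
  rw [hs, List.reverse_append, List.reverse_cons, List.append_assoc, List.singleton_append] at hn ⊢
  exact rowAntisymm_mono hq hη hn

theorem antiT_commute {N : ℕ} {q : ℂ} (hq : q ≠ 0) {η : Fin N → ℂ} (hη : ∀ b, η b ≠ 0)
    {b c : Fin N} (hb : aCoeff q η (η b) ≠ 0) (hc : aCoeff q η (η c) ≠ 0) :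
    Commute (antiT q η (η b)) (antiT q η (η c)) := by
  -- The weight `a` of the exchange relation at `η b`, `η c` is factor `c` of the product in
  -- `aCoeff` at `η b`; `b ^ 2 - c ^ 2` factors as this times minus factor `b` at `η c`.
  -- Invertibility of the determinants thus already excludes degenerate weights.
  have hb' := Finset.prod_ne_zero_iff.mp (neg_ne_zero.mp hb) c (Finset.mem_univ _)
  have hc' := Finset.prod_ne_zero_iff.mp (neg_ne_zero.mp hc) b (Finset.mem_univ _)
  have h := rtt_mono hq hη (List.nodup_reverse.mpr (List.nodup_finRange N)) (hη b) (hη c)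
  refine RTT.antiTrace_commute ?_ ?_ h
  · convert hb' using 1
    have := hη b
    have := hη c
    field_simp
  · convert mul_ne_zero hb' (neg_ne_zero.mpr hc') using 1
    have := hη b
    have := hη c
    field_simp
    ring

end SixVertex

theorem mainTheorem6 {N : ℕ} (q : ℂ) (hq : q ≠ 0) (η : Fin N → ℂ) (hη : ∀ b, η b ≠ 0) :
    (∀ b : Fin N,
      SixVertex.antiT q η (η b) * SixVertex.antiT q η (η b / q) = SixVertex.detMbar q η (η b) ∧
      SixVertex.detMbar q η (η b) =
        (SixVertex.aCoeff q η (η b) * SixVertex.dCoeff η (η b / q)) • (1 : SixVertex.Op N) ∧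
      SixVertex.detM q η (η b) =
        (-(SixVertex.aCoeff q η (η b) * SixVertex.dCoeff η (η b / q))) • (1 : SixVertex.Op N)) ∧
    (∀ (n : Fin N) (X : Matrix (Fin 2) (Fin 2) ℂ),
      (∀ b, b ≤ n → SixVertex.aCoeff q η (η b) ≠ 0 ∧ SixVertex.dCoeff η (η b / q) ≠ 0) →
      SixVertex.localOp n X =
        SixVertex.prodLT n (fun b => SixVertex.antiT q η (η b)) *
        Matrix.trace (SixVertex.monodromy q η (η n) * SixVertex.auxOp N X *
          SixVertex.auxOp N SixVertex.sigmaX) *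
        SixVertex.prodLE n (fun b =>
          SixVertex.antiT q η (η b / q) * (SixVertex.detMbar q η (η b))⁻¹) ∧
      SixVertex.localOp n X =
        SixVertex.prodLE n (fun b => SixVertex.antiT q η (η b)) *
        (Matrix.trace (SixVertex.auxOp N SixVertex.sigmaZ *
            (SixVertex.monodromy q η (η n / q)).transpose *
            SixVertex.auxOp N SixVertex.sigmaZ * SixVertex.auxOp N X *
            SixVertex.auxOp N SixVertex.sigmaX) *
          (SixVertex.detM q η (η n))⁻¹) *
        SixVertex.prodLT n (fun b =>
          SixVertex.antiT q η (η b / q) * (SixVertex.detMbar q η (η b))⁻¹)) := by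
  open SixVertex in
  have hdet : ∀ b, detM q η (η b) =
      (-(aCoeff q η (η b) * dCoeff η (η b / q))) • (1 : Op N) := fun b => detM_eq hq hη (hη b)
  have hTT : ∀ b, antiT q η (η b) * antiT q η (η b / q) = detMbar q η (η b) := fun b =>
    (rowAntisymm_monodromy hq hη b).antiTrace_mul_antiTrace
  refine ⟨fun b => ⟨hTT b, ?_, hdet b⟩, fun n X hn => ?_⟩
  · rw [detMbar_eq_neg, hdet, ← neg_smul, neg_neg]
  have hunit : ∀ b, b ≤ n → IsUnit (detMbar q η (η b)).det := by
    intro b hb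
    rw [← Matrix.isUnit_iff_isUnit_det, detMbar_eq_neg, hdet, ← neg_smul, neg_neg]
    rw [← Algebra.algebraMap_eq_smul_one]
    exact (IsUnit.mk0 _ (mul_ne_zero (hn b hb).1 (hn b hb).2)).map _
  have hU : ∀ b, b ≤ n →
      antiT q η (η b) * (antiT q η (η b / q) * (detMbar q η (η b))⁻¹) = 1 := by
    intro b hb
    rw [← mul_assoc, hTT, Matrix.mul_nonsing_inv _ (hunit b hb)]
  have hc : ∀ b, b ≤ n → ∀ c, c ≤ n → Commute (antiT q η (η b)) (antiT q η (η c)) :=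
    fun b hb c hc => antiT_commute hq hη (hn b hb).1 (hn c hc).1
  have hLE : prodLE n (fun b => antiT q η (η b)) *
      prodLE n (fun b => antiT q η (η b / q) * (detMbar q η (η b))⁻¹) = 1 := by
    refine list_prod_mul_prod _ _ _ (fun b hb => hU b ?_) fun b hb c hc' => hc b ?_ c ?_ <;>
      simp_all
  have hLT : prodLT n (fun b => antiT q η (η b)) *
      prodLT n (fun b => antiT q η (η b / q) * (detMbar q η (η b))⁻¹) = 1 := by
    refine list_prod_mul_prod _ _ _ (fun b hb => hU b ?_) fun b hb c hc' => hc b ?_ c ?_ <;>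
      simp_all [le_of_lt]
  have hX : prodLT n (fun b => antiT q η (η b)) * twistTrace X (monodromy q η (η n)) =
      localOp n X * prodLE n (fun b => antiT q η (η b)) := by
    rw [prodLE_eq]
    exact prod_mul_twistTrace hq hη
      (filter_split n _ (List.pairwise_lt_finRange N) (List.mem_finRange n)).1.symm
      (List.nodup_finRange N) X
  rw [trace_mul_auxOp, trace_transpose_mul_auxOp]
  constructor
  · rw [hX, mul_assoc, hLE, mul_one]
  · have hneg : (detM q η (η n))⁻¹ = -(detMbar q η (η n))⁻¹ := by
      refine Matrix.inv_eq_right_inv ?_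
      rw [mul_neg, ← neg_mul, ← detMbar_eq_neg, Matrix.mul_nonsing_inv _ (hunit n le_rfl)]
    -- The sign from row antisymmetry cancels the one between `detM` and `detMbar`.
    have hT : antiT q η (η n) * cotwistTrace X (monodromy q η (η n / q)) *
        (detM q η (η n))⁻¹ = twistTrace X (monodromy q η (η n)) *
          (antiT q η (η n / q) * (detMbar q η (η n))⁻¹) := by
      rw [hneg, antiT_eq, (rowAntisymm_monodromy hq hη n).antiTrace_mul_cotwistTrace, neg_mul_neg,
        mul_assoc, antiT_eq]
    -- After `hX` the last transfer matrix meets its right inverse at site `n`, and only the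
    -- products over earlier sites remain to be cancelled.
    rw [prodLE_eq, mul_assoc (prodLT n _), ← mul_assoc (antiT q η (η n)), hT,
      ← mul_assoc (prodLT n _), hX, prodLE_eq, ← mul_assoc (localOp n X), mul_assoc _ _
        (antiT q η (η n / q) * _), hU n le_rfl, mul_one, mul_assoc, hLT, mul_one]
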